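/- Let $\mathbb{F}$ be a field, $\mathrm{U} \subseteq \mathbb{F}^\times$ a subgroup and $n \ge 2$. For a nonzero vector $\vec v \in \mathbb{F}^n$ write $[\vec v] = \{c\vec v : c \in \mathrm{U}\}$; such sets are called $\mathrm{U}$-vectors. A partial $\mathrm{U}$-basis is a finite set $\{[\vec v_1], \dots, [\vec v_k]\}$ of $k$ distinct $\mathrm{U}$-vectors such that $\{\vec v_1, \dots, \vec v_k\}$ is a subset of a basis of $\mathbb{F}^n$. It is a determinant-$\mathrm{U}$ partial $\mathrm{U}$-basis if either $k < n$, or $k = n$ and the vectors can be ordered so that $\det(\vec v_1, \dots, \vec v_n) \in \mathrm{U}$ (the order is irrelevant if $-1 \in \mathrm{U}$). An augmented determinant-$\mathrm{U}$ partial $\mathrm{U}$-basis is a set $\{[\vec v_0], [\vec v_1], \dots, [\vec v_k]\}$ of $\mathrm{U}$-vectors, $k \ge 2$, such that $\{[\vec v_1], \dots, [\vec v_k]\}$ is a determinant-$\mathrm{U}$ partial $\mathrm{U}$-basis and $\vec v_0 = \lambda \vec v_1 + \nu \vec v_2$ for some $\lambda, \nu \in \mathrm{U}$. Let $\mathrm{BD}_n^{\mathrm{U}}(\mathbb{F})$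 be the simplicial complex whose simplices are the nonempty determinant-$\mathrm{U}$ partial $\mathrm{U}$-bases of $\mathbb{F}^n$, and let $\mathrm{BDA}_n^{\mathrm{U}}(\mathbb{F}) \supseteq \mathrm{BD}_n^{\mathrm{U}}(\mathbb{F})$ be the simplicial complex whose simplices are these together with the augmented determinant-$\mathrm{U}$ partial $\mathrm{U}$-bases. Let $\{[\vec v_1], \dots, [\vec v_n]\}$ be an $(n-1)$-simplex of $\mathrm{BD}_n^{\mathrm{U}}(\mathbb{F})$ and let $u_1, \dots, u_n \in \mathrm{U}$. Then $u_1\vec v_1 + \dots + u_n\vec v_n \neq 0$; omitting any one of the $n+1$ vertices $[\vec v_1], \dots, [\vec v_n], [u_1\vec v_1 + \dots + u_n\vec v_n]$ leaves a simplex of $\mathrm{BD}_n^{\mathrm{U}}(\mathbb{F})$; and the map $$\partial\Delta^n \cong S^{n-1} \to \mathrm{BD}_n^{\mathrm{U}}(\mathbb{F})$$ of geometric realizations that sends the vertices of $\Delta^n$ to these $n+1$ vertices in this order, and is linear on each simplex of $\partial\Delta^n$, becomes nullhomotopic (that is, homotopic to a constant map) after composition with the inclusion $\mathrm{BD}_n^{\mathrm{U}}(\mathbb{F})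 \hookrightarrow \mathrm{BDA}_n^{\mathrm{U}}(\mathbb{F})$. -/

import Mathlib

/-! ### Geometric realizations of abstract simplicial complexes -/

namespace SimplicialRealization

/-- The geometric realization of an abstract simplicial complex `K`, as the set of barycentric
coordinates: finitely supported functions on the vertices with nonnegative values of sum `1`,
whose support is a face of `K`. -/
structure Realization {V : Type*} (K : PreAbstractSimplicialComplex V) where
  /-- The barycentric coordinates. -/
  coord : V →₀ ℝ
  nonneg : ∀ a, 0 ≤ coord a
  support_mem : coord.support ∈ K.faces
  sum_eq : (coord.sum fun _ c => c) = 1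

theorem Realization.ext {V : Type*} {K : PreAbstractSimplicialComplex V} {x y : Realization K}
    (h : x.coord = y.coord) : x = y := by
  cases x
  cases y
  subst h
  rfl

theorem nonempty_support {V : Type*} {x : V →₀ ℝ} (h : (x.sum fun _ c => c) = 1) :
    x.support.Nonempty := by
  by_contra h'
  rw [Finset.not_nonempty_iff_eq_empty, Finsupp.support_eq_empty] at h'
  rw [h', Finsupp.sum_zero_index] at h
  exact zero_ne_one h

/-- The tautological map from the standard simplex on the vertices of a face `s` of `K`
to the realization of `K`. -/
noncomputable def faceMap {V : Type*} (K : PreAbstractSimplicialComplex V)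
    (s : Finset V) (hs : s ∈ K.faces) (x : stdSimplex ℝ s) : Realization K :=
  have hsum : ((Finsupp.equivFunOnFinite.symm (x : s → ℝ)).embDomain
      (Function.Embedding.subtype _)).sum (fun _ c => c) = 1 := by
    rw [Finsupp.sum_embDomain, Finsupp.sum_fintype _ _ (fun _ => rfl)]
    exact x.2.2
  { coord := (Finsupp.equivFunOnFinite.symm (x : s → ℝ)).embDomain (Function.Embedding.subtype _)
    nonneg := fun a => by
      by_cases ha : a ∈ s
      · have h := Finsupp.embDomain_apply_self (Function.Embedding.subtype (· ∈ s))
          (Finsupp.equivFunOnFinite.symm (x : s → ℝ)) ⟨a, ha⟩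
        simp only [Function.Embedding.subtype_apply] at h
        rw [h]
        exact x.2.1 _
      · rw [Finsupp.embDomain_of_notMem_range]
        simpa using ha
    support_mem := by
      refine (K.isRelLowerSet_faces hs).2 ?_ (nonempty_support hsum)
      intro a ha
      rw [Finsupp.support_embDomain, Finset.mem_map] at ha
      obtain ⟨b, -, rfl⟩ := ha
      exact b.2
    sum_eq := hsum }

/-- The weak (coherent) topology: a set is open iff its preimage in each closed face is open. -/
noncomputable instance {V : Type*} (K : PreAbstractSimplicialComplex V) : TopologicalSpace (Realization K) :=
  ⨆ (s : Finset V) (hs : s ∈ K.faces), TopologicalSpace.coinduced (faceMap K s hs) inferInstance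

theorem continuous_faceMap {V : Type*} (K : PreAbstractSimplicialComplex V)
    (s : Finset V) (hs : s ∈ K.faces) : Continuous (faceMap K s hs) := by
  rw [continuous_iff_coinduced_le]
  exact le_iSup₂_of_le s hs le_rfl

open Classical in
/-- The map of realizations `|K| → |L|` induced by a simplicial map `f`, obtained by extending
`f` linearly over each simplex. -/
noncomputable def mapFun {V W : Type*} (K : PreAbstractSimplicialComplex V)
    (L : PreAbstractSimplicialComplex W) (f : V → W)
    (hf : ∀ s ∈ K.faces, s.image f ∈ L.faces) (x : Realization K) : Realization L :=
  have hsum : (x.coord.mapDomain f).sum (fun _ c => c) = 1 := by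
    rw [Finsupp.sum_mapDomain_index (fun _ => rfl) (fun _ _ _ => rfl)]
    exact x.sum_eq
  { coord := x.coord.mapDomain f
    nonneg := fun a => by
      rw [Finsupp.mapDomain, Finsupp.sum_apply]
      refine Finset.sum_nonneg fun b _ => ?_
      change 0 ≤ Finsupp.single (f b) (x.coord b) a
      rw [Finsupp.single_apply]
      split_ifs
      · exact x.nonneg b
      · exact le_rfl
    support_mem := (L.isRelLowerSet_faces (hf _ x.support_mem)).2 Finsupp.mapDomain_support
      (nonempty_support hsum)
    sum_eq := hsum }

open Classical in
theorem continuous_mapFun {V W : Type*} (K : PreAbstractSimplicialComplex V)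
    (L : PreAbstractSimplicialComplex W) (f : V → W)
    (hf : ∀ s ∈ K.faces, s.image f ∈ L.faces) : Continuous (mapFun K L f hf) := by
  refine continuous_iSup_dom.2 fun s => continuous_iSup_dom.2 fun hs => ?_
  rw [continuous_coinduced_dom]
  let g : s → (s.image f : Finset W) := fun a => ⟨f a, Finset.mem_image_of_mem f a.2⟩
  have : mapFun K L f hf ∘ faceMap K s hs =
      faceMap L (s.image f) (hf s hs) ∘ stdSimplex.map g := by
    funext x
    apply Realization.ext
    change Finsupp.mapDomain f (Finsupp.embDomain _ _) = Finsupp.embDomain _ _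
    rw [Finsupp.embDomain_eq_mapDomain, Finsupp.embDomain_eq_mapDomain, ← Finsupp.mapDomain_comp]
    have : Finsupp.equivFunOnFinite.symm ((stdSimplex.map g x : stdSimplex ℝ _) : _ → ℝ) =
        Finsupp.mapDomain g (Finsupp.equivFunOnFinite.symm (x : s → ℝ)) := by
      ext b
      simp only [stdSimplex.map_coe, Finsupp.equivFunOnFinite_symm_apply_apply,
        FunOnFinite.linearMap_apply_apply, Finsupp.mapDomain, Finsupp.sum_apply]
      rw [Finsupp.sum_fintype _ _ (fun _ => by simp), Finset.sum_filter]
      simp [Finsupp.single_apply]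
    rw [this, ← Finsupp.mapDomain_comp]
    rfl
  rw [this]
  exact (continuous_faceMap L _ _).comp (stdSimplex.continuous_map g)

open Classical in
/-- The continuous map `|K| → |L|` induced by a simplicial map. -/
noncomputable def map {V W : Type*} (K : PreAbstractSimplicialComplex V)
    (L : PreAbstractSimplicialComplex W) (f : V → W)
    (hf : ∀ s ∈ K.faces, s.image f ∈ L.faces) : C(Realization K, Realization L) :=
  ⟨mapFun K L f hf, continuous_mapFun K L f hf⟩

/-- The inclusion of realizations of a subcomplex `K` of `L`. -/
noncomputable def inclusion {V : Type*} {K L : PreAbstractSimplicialComplex V} (h : K ≤ L) :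
    C(Realization K, Realization L) :=
  map K L id fun s hs => by
    simpa only [Finset.image_id] using h hs

/-- `∂Δᵏ`: the complex of all nonempty proper subsets of the `k + 1` vertices. -/
def simplexBoundary (k : ℕ) : PreAbstractSimplicialComplex (Fin (k + 1)) where
  faces := {s | s.Nonempty ∧ s ≠ Finset.univ}
  isRelLowerSet_faces := fun _ hs => ⟨hs.1, fun _ hts ht =>
    ⟨ht, fun h => hs.2 (Finset.univ_subset_iff.1 (h ▸ hts))⟩⟩

open Classical in
/-- Omitting any one of the (not necessarily distinct) vertices `w₀, …, w_k` leaves a simplex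
of `K`. -/
def FacetsIn {V : Type*} (K : PreAbstractSimplicialComplex V) {k : ℕ} (w : Fin (k + 1) → V) :
    Prop :=
  ∀ i, (Finset.univ.erase i).image w ∈ K.faces

open Classical in
/-- The map `∂Δᵏ → |K|` that sends the `i`-th vertex to `wᵢ` and is linear on each simplex,
defined when omitting any one of the `wᵢ` leaves a simplex of `K`. -/
noncomputable def sphereMap {V : Type*} (K : PreAbstractSimplicialComplex V) {k : ℕ}
    (w : Fin (k + 1) → V) (hw : FacetsIn K w) :
    C(Realization (simplexBoundary k), Realization K) :=
  map (simplexBoundary k) K w fun s hs => by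
    obtain ⟨hne, hs⟩ := hs
    obtain ⟨i, hi⟩ : ∃ i, i ∉ s := by
      by_contra! h
      exact hs (Finset.eq_univ_iff_forall.2 h)
    refine (K.isRelLowerSet_faces (hw i)).2 ?_ (hne.image w)
    refine Finset.image_subset_image fun j hj => ?_
    exact Finset.mem_erase.2 ⟨fun h => hi (h ▸ hj), Finset.mem_univ j⟩

end SimplicialRealization

/-! ### Complexes of partial bases up to units in `U` -/

namespace UBases

variable {R : Type*} [CommRing R]

/-- The set `[v] = {c v | c ∈ U}`. -/
def uClass (U : Subgroup Rˣ) {n : ℕ} (v : Fin n → R) : Set (Fin n → R) :=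
  {w | ∃ c ∈ U, w = c • v}

/-- `U`-vectors in `Rⁿ`: the sets `[v]` for `v ≠ 0`. -/
abbrev UVector (U : Subgroup Rˣ) (n : ℕ) : Type _ :=
  {x : Set (Fin n → R) // ∃ v : Fin n → R, v ≠ 0 ∧ x = uClass U v}

/-- The `U`-vector of a nonzero vector. -/
def UVector.mk (U : Subgroup Rˣ) {n : ℕ} (v : Fin n → R) (hv : v ≠ 0) : UVector U n :=
  ⟨uClass U v, v, hv, rfl⟩

/-- A partial basis of `Rⁿ`: a subset of a free basis. -/
def IsPartialBasis {n : ℕ} (S : Set (Fin n → R)) : Prop :=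
  ∃ b : Module.Basis (Fin n) R (Fin n → R), S ⊆ Set.range b

/-- A partial `U`-basis: a set of `U`-vectors whose representatives form a partial basis. -/
def IsPartialUBasis (U : Subgroup Rˣ) {n : ℕ} (s : Finset (UVector U n)) : Prop :=
  ∃ r : UVector U n → (Fin n → R),
    (∀ x ∈ s, r x ∈ x.1) ∧ IsPartialBasis (r '' (s : Set (UVector U n)))

/-- A determinant-`U` partial `U`-basis: if it has `n` elements `e₁, …, eₙ` (in some order),
with representatives `v₁, …, vₙ`, then the matrix with columns `v₁, …, vₙ` has determinant
in `U`. -/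
def IsDetPartialUBasis (U : Subgroup Rˣ) {n : ℕ} (s : Finset (UVector U n)) : Prop :=
  IsPartialUBasis U s ∧
    (s.card = n → ∃ (e : Fin n → UVector U n) (v : Fin n → Fin n → R),
      Set.range e = (s : Set (UVector U n)) ∧ (∀ i, v i ∈ (e i).1) ∧
      ∃ c ∈ U, (Matrix.of fun i j => v j i).det = (c : R))

open Classical in
/-- An augmented determinant-`U` partial `U`-basis: a determinant-`U` partial `U`-basis together
with one more `U`-vector `x₀ = [λ v₁ + ν v₂]`, for representatives `v₁, v₂` of two distinct
elements of it and `λ, ν ∈ U`. -/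
def IsAugDetPartialUBasis (U : Subgroup Rˣ) {n : ℕ} (s : Finset (UVector U n)) : Prop :=
  ∃ x₀ ∈ s, IsDetPartialUBasis U (s.erase x₀) ∧
    ∃ x₁ ∈ s.erase x₀, ∃ x₂ ∈ s.erase x₀, x₁ ≠ x₂ ∧
      ∃ v₀ ∈ x₀.1, ∃ v₁ ∈ x₁.1, ∃ v₂ ∈ x₂.1, ∃ l ∈ U, ∃ m ∈ U, v₀ = l • v₁ + m • v₂

theorem UVector.eq_of_mem {U : Subgroup Rˣ} {n : ℕ} {x y : UVector U n} {w : Fin n → R}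
    (hx : w ∈ x.1) (hy : w ∈ y.1) : x = y := by
  obtain ⟨x, v, hv, rfl⟩ := x
  obtain ⟨y, v', hv', rfl⟩ := y
  obtain ⟨c, hc, rfl⟩ := hx
  obtain ⟨d, hd, h⟩ := hy
  apply Subtype.ext
  have h' : v = (c⁻¹ * d) • v' := by rw [mul_smul, ← h, inv_smul_smul]
  ext z
  constructor
  · rintro ⟨a, ha, rfl⟩
    exact ⟨a * (c⁻¹ * d), U.mul_mem ha (U.mul_mem (U.inv_mem hc) hd), by rw [mul_smul, ← h']⟩
  · rintro ⟨a, ha, rfl⟩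
    refine ⟨a * (c⁻¹ * d)⁻¹, U.mul_mem ha (U.inv_mem (U.mul_mem (U.inv_mem hc) hd)), ?_⟩
    rw [h', mul_smul, inv_smul_smul]

theorem UVector.exists_smul {U : Subgroup Rˣ} {n : ℕ} {x : UVector U n} {w w' : Fin n → R}
    (hw : w ∈ x.1) (hw' : w' ∈ x.1) : ∃ c ∈ U, w = c • w' := by
  obtain ⟨x, v, hv, rfl⟩ := x
  obtain ⟨c, hc, rfl⟩ := hw
  obtain ⟨d, hd, rfl⟩ := hw'
  exact ⟨c * d⁻¹, U.mul_mem hc (U.inv_mem hd), by rw [mul_smul, inv_smul_smul]⟩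

theorem IsPartialUBasis.card_le {U : Subgroup Rˣ} {n : ℕ} {s : Finset (UVector U n)}
    (hs : IsPartialUBasis U s) : s.card ≤ n := by
  classical
  obtain ⟨r, hr, b, hb⟩ := hs
  have h1 : s.image r ⊆ Finset.univ.image b := by
    intro y hy
    obtain ⟨x, hx, rfl⟩ := Finset.mem_image.1 hy
    obtain ⟨i, hi⟩ := hb ⟨x, hx, rfl⟩
    exact Finset.mem_image.2 ⟨i, Finset.mem_univ i, hi⟩
  have h2 : (s.image r).card = s.card := Finset.card_image_of_injOn fun x hx y hy h =>
    UVector.eq_of_mem (hr x hx) (by rw [h]; exact hr y hy)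
  calc s.card = (s.image r).card := h2.symm
    _ ≤ (Finset.univ.image b).card := Finset.card_le_card h1
    _ ≤ n := by simpa using Finset.card_image_le (s := Finset.univ) (f := b)

theorem IsDetPartialUBasis.subset {U : Subgroup Rˣ} {n : ℕ} {s t : Finset (UVector U n)}
    (hs : IsDetPartialUBasis U s) (h : t ⊆ s) : IsDetPartialUBasis U t := by
  refine ⟨?_, fun ht => ?_⟩
  · obtain ⟨⟨r, hr, b, hb⟩, -⟩ := hs
    exact ⟨r, fun x hx => hr x (h hx), b, (Set.image_mono (by exact_mod_cast h)).trans hb⟩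
  · have hst : t = s := Finset.eq_of_subset_of_card_le h (hs.1.card_le.trans ht.ge)
    subst hst
    exact hs.2 ht

theorem map_update_comb {ι M N : Type*} [DecidableEq ι] [AddCommGroup M] [Module R M]
    [AddCommGroup N] [Module R N] (f : M [⋀^ι]→ₗ[R] N) (v : ι → M) {i j : ι} (hij : i ≠ j)
    (a b : R) : f (Function.update v i (a • v i + b • v j)) = a • f v := by
  rw [f.map_update_add, f.map_update_smul, f.map_update_smul, f.map_update_self v hij,
    Function.update_eq_self, smul_zero, add_zero]

theorem det_columns {n : ℕ} (v : Fin n → Fin n → R) :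
    (Matrix.of fun i j => v j i).det = Matrix.detRowAlternating v :=
  Matrix.det_transpose (Matrix.of v)

open Classical in
/-- Exchanging an element `x₁` of a determinant-`U` partial `U`-basis for `[l v₁ + m v₂]`. -/
theorem IsDetPartialUBasis.exchange {U : Subgroup Rˣ} {n : ℕ} {s : Finset (UVector U n)}
    (hs : IsDetPartialUBasis U s) {x₀ x₁ x₂ : UVector U n} (h0 : x₀ ∉ s) (h1 : x₁ ∈ s)
    (h2 : x₂ ∈ s) (h12 : x₁ ≠ x₂) {v₀ v₁ v₂ : Fin n → R} (hv0 : v₀ ∈ x₀.1) (hv1 : v₁ ∈ x₁.1)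
    (hv2 : v₂ ∈ x₂.1) {l m : Rˣ} (hl : l ∈ U) (hm : m ∈ U) (hv : v₀ = l • v₁ + m • v₂) :
    IsDetPartialUBasis U (insert x₀ (s.erase x₁)) := by
  obtain ⟨⟨r, hr, b, hb⟩, hdet⟩ := hs
  have key : ∀ w₁ ∈ x₁.1, ∀ w₂ ∈ x₂.1, ∃ l' ∈ U, ∃ m' ∈ U,
      v₀ = (l' : R) • w₁ + (m' : R) • w₂ := by
    intro w₁ hw₁ w₂ hw₂
    obtain ⟨c, hc, rfl⟩ := UVector.exists_smul hv1 hw₁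
    obtain ⟨d, hd, rfl⟩ := UVector.exists_smul hv2 hw₂
    refine ⟨l * c, U.mul_mem hl hc, m * d, U.mul_mem hm hd, ?_⟩
    rw [hv, smul_smul, smul_smul]
    rfl
  refine ⟨⟨Function.update r x₀ v₀, ?_, ?_⟩, fun hcard => ?_⟩
  · intro x hx
    by_cases h : x = x₀
    · subst h
      simpa using hv0
    · rw [Function.update_of_ne h]
      exact hr x (Finset.mem_of_mem_erase (Finset.mem_of_mem_insert_of_ne hx h))
  · obtain ⟨i, hi⟩ := hb ⟨x₁, h1, rfl⟩
    obtain ⟨j, hj⟩ := hb ⟨x₂, h2, rfl⟩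
    have hij : i ≠ j := by
      rintro rfl
      have h3 := hr x₁ h1
      rw [← hi, hj] at h3
      exact h12 (UVector.eq_of_mem h3 (hr x₂ h2))
    obtain ⟨l', -, m', -, h⟩ := key _ (hr x₁ h1) _ (hr x₂ h2)
    rw [← hi, ← hj] at h
    have hu : IsUnit (b.det (Function.update b i v₀)) := by
      rw [h, map_update_comb b.det b hij, b.det_self, smul_eq_mul, mul_one]
      exact l'.isUnit
    obtain ⟨hli, hsp⟩ := (b.is_basis_iff_det).2 hu
    refine ⟨Module.Basis.mk hli hsp.ge, ?_⟩
    rw [Module.Basis.coe_mk]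
    rintro - ⟨x, hx, rfl⟩
    by_cases hx0 : x = x₀
    · subst hx0
      exact ⟨i, by simp⟩
    · rw [Function.update_of_ne hx0]
      have hx' : x ∈ s.erase x₁ := Finset.mem_of_mem_insert_of_ne hx hx0
      obtain ⟨k, hk⟩ := hb ⟨x, Finset.mem_of_mem_erase hx', rfl⟩
      refine ⟨k, ?_⟩
      rw [Function.update_of_ne, hk]
      rintro rfl
      have h3 := hr x (Finset.mem_of_mem_erase hx')
      rw [← hk, hi] at h3
      exact Finset.ne_of_mem_erase hx' (UVector.eq_of_mem h3 (hr x₁ h1))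
  · have hc : s.card = n := by
      rw [Finset.card_insert_of_notMem (fun h => h0 (Finset.mem_of_mem_erase h)),
        Finset.card_erase_add_one h1] at hcard
      exact hcard
    obtain ⟨e, v, he, hve, c, hcU, hcdet⟩ := hdet hc
    have himg : Finset.univ.image e = s := by
      apply Finset.coe_injective
      rw [Finset.coe_image, Finset.coe_univ, Set.image_univ, he]
    have hinj : Function.Injective e := by
      rw [← Set.injOn_univ, ← Finset.coe_univ, ← Finset.card_image_iff, himg, hc,
        Finset.card_univ, Fintype.card_fin]
    obtain ⟨i, hi⟩ : x₁ ∈ Set.range e := by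
      rw [he]
      exact h1
    obtain ⟨j, hj⟩ : x₂ ∈ Set.range e := by
      rw [he]
      exact h2
    have hij : i ≠ j := fun h => h12 (by rw [← hi, ← hj, h])
    obtain ⟨l', hl', m', -, h⟩ := key (v i) (hi ▸ hve i) (v j) (hj ▸ hve j)
    refine ⟨Function.update e i x₀, Function.update v i v₀, ?_, fun k => ?_, l' * c,
      U.mul_mem hl' hcU, ?_⟩
    · ext x
      simp only [Set.mem_range, Finset.mem_coe, Finset.mem_insert, Finset.mem_erase]
      constructor
      · rintro ⟨k, rfl⟩
        by_cases hk : k = i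
        · subst hk
          simp
        · rw [Function.update_of_ne hk]
          refine Or.inr ⟨fun h' => hk (hinj (h'.trans hi.symm)), ?_⟩
          rw [← Finset.mem_coe, ← he]
          exact ⟨k, rfl⟩
      · rintro (rfl | ⟨hx1, hx⟩)
        · exact ⟨i, by simp⟩
        · rw [← Finset.mem_coe, ← he] at hx
          obtain ⟨k, rfl⟩ := hx
          refine ⟨k, Function.update_of_ne ?_ _ _⟩
          rintro rfl
          exact hx1 hi
    · by_cases hk : k = i
      · subst hk
        simpa using hv0
      · rw [Function.update_of_ne hk, Function.update_of_ne hk]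
        exact hve k
    · rw [det_columns] at hcdet ⊢
      rw [h, map_update_comb Matrix.detRowAlternating v hij, hcdet, smul_eq_mul, Units.val_mul]

/-- The complex `BD_n^U(R)` of determinant-`U` partial `U`-bases. -/
def BD (U : Subgroup Rˣ) (n : ℕ) : PreAbstractSimplicialComplex (UVector U n) where
  faces := {s | s.Nonempty ∧ IsDetPartialUBasis U s}
  isRelLowerSet_faces := fun _ hs => ⟨hs.1, fun _ hts ht => ⟨ht, hs.2.subset hts⟩⟩

open Classical in
theorem IsAugDetPartialUBasis.subset {U : Subgroup Rˣ} {n : ℕ} {s t : Finset (UVector U n)}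
    (hs : IsAugDetPartialUBasis U s) (h : t ⊆ s) :
    IsDetPartialUBasis U t ∨ IsAugDetPartialUBasis U t := by
  obtain ⟨x₀, hx₀, hD, x₁, hx₁, x₂, hx₂, h12, v₀, hv₀, v₁, hv₁, v₂, hv₂, l, hl, m, hm, hv⟩ := hs
  by_cases h1 : x₁ ∈ t
  · by_cases h2 : x₂ ∈ t
    · by_cases h0 : x₀ ∈ t
      · exact Or.inr ⟨x₀, h0, hD.subset (Finset.erase_subset_erase x₀ h), x₁,
          Finset.mem_erase.2 ⟨Finset.ne_of_mem_erase hx₁, h1⟩, x₂,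
          Finset.mem_erase.2 ⟨Finset.ne_of_mem_erase hx₂, h2⟩, h12,
          v₀, hv₀, v₁, hv₁, v₂, hv₂, l, hl, m, hm, hv⟩
      · exact Or.inl (hD.subset (Finset.subset_erase.2 ⟨h, h0⟩))
    · refine Or.inl ((hD.exchange (Finset.notMem_erase x₀ s) hx₂ hx₁ h12.symm hv₀ hv₂ hv₁ hm hl
        (hv.trans (add_comm _ _))).subset ?_)
      intro x hx
      by_cases hx0 : x = x₀
      · exact Finset.mem_insert.2 (Or.inl hx0)
      · exact Finset.mem_insert_of_mem (Finset.mem_erase.2 ⟨fun h' => h2 (h' ▸ hx),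
          Finset.mem_erase.2 ⟨hx0, h hx⟩⟩)
  · refine Or.inl ((hD.exchange (Finset.notMem_erase x₀ s) hx₁ hx₂ h12 hv₀ hv₁ hv₂ hl hm
      hv).subset ?_)
    intro x hx
    by_cases hx0 : x = x₀
    · exact Finset.mem_insert.2 (Or.inl hx0)
    · exact Finset.mem_insert_of_mem (Finset.mem_erase.2 ⟨fun h' => h1 (h' ▸ hx),
        Finset.mem_erase.2 ⟨hx0, h hx⟩⟩)

/-- The complex `BDA_n^U(R)` of determinant-`U` partial `U`-bases and augmented determinant-`U`
partial `U`-bases. -/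
def BDA (U : Subgroup Rˣ) (n : ℕ) : PreAbstractSimplicialComplex (UVector U n) where
  faces := {s | s.Nonempty ∧ (IsDetPartialUBasis U s ∨ IsAugDetPartialUBasis U s)}
  isRelLowerSet_faces := fun _ hs => ⟨hs.1, fun _ hts ht => ⟨ht,
    hs.2.elim (fun h => Or.inl (h.subset hts)) (fun h => h.subset hts)⟩⟩

theorem BD_le_BDA (U : Subgroup Rˣ) (n : ℕ) : BD U n ≤ BDA U n :=
  fun _ hs => ⟨hs.1, Or.inl hs.2⟩

end UBases

/-! Replacing each `vᵢ` by `uᵢ vᵢ` keeps the `U`-vectors and multiplies the determinant by an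
element of `U`, so let all `uᵢ` be `1` and number the vectors from `0`. Put `wᵢ = v₀ + ⋯ + vᵢ`. Then
`w₀ = v₀`, and the sphere is spanned by all the `vᵢ` and `wₙ₋₁`. Two facts about simplices are used.
(a) Choosing one of `vᵢ`, `wᵢ` for each `i` is a unitriangular change of basis, hence gives a
simplex of `BD` (`isDetPartialUBasis_image_vertex`). (b) Since `wⱼ = wⱼ₋₁ + vⱼ`, once `wⱼ₋₁` has
replaced some `vₗ` with `l < j`, the vertex `[wⱼ]` can be added as an augmentation
(`isDet_or_isAug_image_vertex`). For `j = n - 1, …, 1`, push the midpoint of the edge from `[vⱼ]` to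
`[wⱼ]` to `[wⱼ₋₁]`. A simplex used by the map and containing this edge misses some `vₗ` with `l <
j`, so by (b) each point moves within one simplex of `BDA`. In the end `vⱼ` and `wⱼ` never occur
together for `j ≥ 1`; by (a) the vertex `[v₀]` can be added to every simplex that occurs, so the
image lies in a cone with apex `[v₀]`. This descent is `nullhomotopic_of_isLevel`. -/

namespace SimplicialRealization

/-! ### Continuity and straight-line homotopies in realizations. -/

theorem continuous_coord {V : Type*} (K : PreAbstractSimplicialComplex V) (a : V) :
    Continuous fun x : Realization K => x.coord a := by
  refine continuous_iSup_dom.2 fun s => continuous_iSup_dom.2 fun hs => ?_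
  rw [continuous_coinduced_dom]
  by_cases ha : a ∈ s
  · have : (fun x : Realization K => x.coord a) ∘ faceMap K s hs =
        fun x : stdSimplex ℝ s => (x : s → ℝ) ⟨a, ha⟩ := by
      funext x
      exact Finsupp.embDomain_apply_self (Function.Embedding.subtype (· ∈ s))
        (Finsupp.equivFunOnFinite.symm (x : s → ℝ)) ⟨a, ha⟩
    rw [this]
    exact (continuous_apply _).comp continuous_subtype_val
  · have : (fun x : Realization K => x.coord a) ∘ faceMap K s hs = fun _ => 0 := by
      funext x
      refine Finsupp.embDomain_of_notMem_range _ _ _ ?_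
      simpa using ha
    rw [this]
    exact continuous_const

/-- A map into the realization of a complex with finitely many vertices is continuous if its
barycentric coordinates are. -/
theorem continuous_of_coord {X V : Type*} [TopologicalSpace X] [Finite V]
    {K : PreAbstractSimplicialComplex V} {f : X → Realization K}
    (hf : ∀ a, Continuous fun x => (f x).coord a) : Continuous f := by
  classical
  -- `C s` is the preimage of the closed face `s`. These finitely many closed sets cover `X`, and on
  -- each of them `f` factors through `faceMap K s`.
  let C : K.faces → Set X := fun s => {x | ∀ a, a ∉ s.1 → (f x).coord a = 0}
  refine (locallyFinite_of_finite C).continuous ?_ ?_ ?_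
  · refine Set.eq_univ_of_forall fun x => Set.mem_iUnion.2 ⟨⟨_, (f x).support_mem⟩, fun a ha => ?_⟩
    exact Finsupp.notMem_support_iff.1 ha
  · intro s
    simp only [C, Set.ofPred_forall]
    exact isClosed_iInter fun a => isClosed_iInter fun _ => isClosed_eq (hf a) continuous_const
  · rintro ⟨s, hs⟩
    rw [continuousOn_iff_continuous_domRestrict]
    have hsum (x : C ⟨s, hs⟩) : ∑ b : s, (f x).coord b = 1 := by
      rw [← (f x).sum_eq, Finsupp.sum_of_support_subset (s := s) _ ?_ _ fun _ _ => rfl,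
        Finset.sum_coe_sort s fun b => (f x).coord b]
      intro a ha
      by_contra h
      exact Finsupp.mem_support_iff.1 ha (x.2 a h)
    let g : C ⟨s, hs⟩ → stdSimplex ℝ s := fun x =>
      ⟨fun b => (f x).coord b, fun b => (f x).nonneg b, hsum x⟩
    have hg : Continuous g := continuous_induced_rng.2
      (continuous_pi fun b => (hf b).comp continuous_subtype_val)
    have : (C ⟨s, hs⟩).domRestrict f = faceMap K s hs ∘ g := by
      funext x
      apply Realization.ext
      ext a
      change (f x).coord a = Finsupp.embDomain _ _ a
      by_cases ha : a ∈ s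
      · exact (Finsupp.embDomain_apply_self (Function.Embedding.subtype (· ∈ s))
          (Finsupp.equivFunOnFinite.symm (g x : s → ℝ)) ⟨a, ha⟩).symm
      · rw [x.2 a ha, Finsupp.embDomain_of_notMem_range]
        simpa using ha
    rw [this]
    exact (continuous_faceMap K s hs).comp hg

/-- Two maps into a realization are homotopic if their values at each point lie in a common
closed face. -/
theorem homotopic_of_contiguous {X V : Type*} [TopologicalSpace X] [Finite V] [DecidableEq V]
    {K : PreAbstractSimplicialComplex V} (f g : C(X, Realization K))
    (h : ∀ x, (f x).coord.support ∪ (g x).coord.support ∈ K.faces) : f.Homotopic g := by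
  have hsum (p : unitInterval × X) :
      (((1 - (p.1 : ℝ)) • (f p.2).coord + (p.1 : ℝ) • (g p.2).coord).sum fun _ c => c) = 1 := by
    rw [Finsupp.sum_add_index' (fun _ => rfl) (fun _ _ _ => rfl),
      Finsupp.sum_smul_index (fun _ => rfl), Finsupp.sum_smul_index (fun _ => rfl),
      ← Finsupp.mul_sum, ← Finsupp.mul_sum, (f p.2).sum_eq, (g p.2).sum_eq]
    ring
  let H : unitInterval × X → Realization K := fun p =>
    { coord := (1 - (p.1 : ℝ)) • (f p.2).coord + (p.1 : ℝ) • (g p.2).coord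
      nonneg := fun a => add_nonneg
        (mul_nonneg (sub_nonneg.2 p.1.2.2) ((f p.2).nonneg a))
        (mul_nonneg p.1.2.1 ((g p.2).nonneg a))
      support_mem := (K.isRelLowerSet_faces (h p.2)).2
        (Finsupp.support_add.trans (Finset.union_subset_union Finsupp.support_smul
          Finsupp.support_smul)) (nonempty_support (hsum p))
      sum_eq := hsum p }
  have hH : Continuous H := by
    refine continuous_of_coord fun a => ?_
    have h1 : Continuous fun p : unitInterval × X => (f p.2).coord a :=
      ((continuous_coord K a).comp f.continuous).comp continuous_snd
    have h2 : Continuous fun p : unitInterval × X => (g p.2).coord a :=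
      ((continuous_coord K a).comp g.continuous).comp continuous_snd
    have h3 : Continuous fun p : unitInterval × X => (p.1 : ℝ) :=
      continuous_subtype_val.comp continuous_fst
    exact ((continuous_const.sub h3).mul h1).add (h3.mul h2)
  refine ⟨⟨⟨H, hH⟩, fun x => Realization.ext ?_, fun x => Realization.ext ?_⟩⟩
  · simp [H]
  · simp [H]

/-! ### Pulled-back complexes and maps given by weights. -/

open Classical in
/-- The complex of nonempty sets of vertices with image in a face of `K`. -/
def comap {V W : Type*} (φ : W → V) (K : PreAbstractSimplicialComplex V) :
    PreAbstractSimplicialComplex W where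
  faces := {s | s.Nonempty ∧ s.image φ ∈ K.faces}
  isRelLowerSet_faces := fun _ hs => ⟨hs.1, fun _ hts ht => ⟨ht,
    (K.isRelLowerSet_faces hs.2).2 (Finset.image_subset_image hts) (ht.image φ)⟩⟩

/-- Frees the image from the classical decidability instance in the definition; `facetsIn_iff` does
the same for `FacetsIn`. -/
theorem mem_comap_faces {V W : Type*} [DecidableEq V] {φ : W → V}
    {K : PreAbstractSimplicialComplex V} {s : Finset W} :
    s ∈ (comap φ K).faces ↔ s.Nonempty ∧ s.image φ ∈ K.faces := by
  change _ ∧ _ ↔ _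
  convert Iff.rfl

theorem facetsIn_iff {V : Type*} [DecidableEq V] {K : PreAbstractSimplicialComplex V} {k : ℕ}
    {w : Fin (k + 1) → V} : FacetsIn K w ↔ ∀ i, (Finset.univ.erase i).image w ∈ K.faces := by
  unfold FacetsIn
  convert Iff.rfl

/-- The map into the realization of `K` with prescribed barycentric coordinates. -/
noncomputable def ofWeights {X V : Type*} [TopologicalSpace X] [Fintype V]
    (K : PreAbstractSimplicialComplex V) (a : X → V → ℝ) (ha : Continuous a)
    (h0 : ∀ x p, 0 ≤ a x p) (h1 : ∀ x, ∑ p, a x p = 1)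
    (hK : ∀ x, (Finsupp.equivFunOnFinite.symm (a x)).support ∈ K.faces) : C(X, Realization K) where
  toFun x :=
    { coord := Finsupp.equivFunOnFinite.symm (a x)
      nonneg := h0 x
      support_mem := hK x
      sum_eq := by
        rw [Finsupp.sum_fintype _ _ fun _ => rfl]
        exact h1 x }
  continuous_toFun := continuous_of_coord fun p => (continuous_apply p).comp ha

/-! ### Shifting weights down through the levels. -/

/-- Barycentric coordinates on formal vertices `(i, false)`, `(i, true)` such that the
second copy is only used from `j` on, the two copies of `i` are not used at the same time for
`j < i`, and one of `(0, false), …, (j, false), (j, true)` is not used. -/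
structure IsLevel {n : ℕ} (j : ℕ) (a : Fin n × Bool → ℝ) : Prop where
  lower : ∀ i : Fin n, i.val < j → a (i, true) = 0
  upper : ∀ i : Fin n, j < i.val → a (i, false) = 0 ∨ a (i, true) = 0
  missing : ∀ i : Fin n, i.val = j → a (i, true) = 0 ∨ ∃ k ≤ i, a (k, false) = 0

/-- Move the common weight of `(j, false)` and `(j, true)` to `(k, true)`. -/
def shiftWeight {n : ℕ} (k j : Fin n) (a : Fin n × Bool → ℝ) (p : Fin n × Bool) : ℝ :=
  a p - (if p.1 = j then min (a (j, false)) (a (j, true)) else 0) +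
    if p = (k, true) then 2 * min (a (j, false)) (a (j, true)) else 0

theorem continuous_shiftWeight {n : ℕ} (k j : Fin n) : Continuous (shiftWeight k j) := by
  unfold shiftWeight
  refine continuous_pi fun p => ?_
  split_ifs <;> fun_prop

theorem shiftWeight_nonneg {n : ℕ} (k j : Fin n) {a : Fin n × Bool → ℝ} (h : ∀ p, 0 ≤ a p)
    (p : Fin n × Bool) : 0 ≤ shiftWeight k j a p := by
  have hm : 0 ≤ min (a (j, false)) (a (j, true)) := le_min (h _) (h _)
  obtain ⟨i, b⟩ := p
  unfold shiftWeight
  refine add_nonneg (sub_nonneg.2 ?_) (by split_ifs <;> linarith)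
  split_ifs with hi
  · simp only at hi
    subst hi
    cases b
    exacts [min_le_left _ _, min_le_right _ _]
  · exact h _

/-- Each of the two copies of `j` loses the minimum, and `(k, true)` gains it twice. -/
theorem sum_shiftWeight {n : ℕ} (k j : Fin n) (a : Fin n × Bool → ℝ) :
    ∑ p, shiftWeight k j a p = ∑ p, a p := by
  simp only [shiftWeight, Finset.sum_add_distrib, Finset.sum_sub_distrib, Finset.sum_ite_eq',
    Finset.mem_univ, if_true]
  simp only [Fintype.sum_prod_type, Fintype.sum_bool, Finset.sum_add_distrib, Finset.sum_ite_eq',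
    Finset.mem_univ, if_true]
  ring

/-- Subtracting the minimum kills one of the two weights at `j`, which extends `upper` to `j`. For
`missing` at `k`: if nothing moves, `(k, true)` keeps weight `0`; otherwise both copies of `j` have
positive weight, so the unused `(l, false)` has `l < j`, and its weight is not touched. -/
theorem IsLevel.shiftWeight {n : ℕ} {k j : Fin n} (hkj : k.val + 1 = j.val)
    {a : Fin n × Bool → ℝ} (h : ∀ p, 0 ≤ a p) (ha : IsLevel j.val a) :
    IsLevel k.val (shiftWeight k j a) := by
  have hk : k ≠ j := fun h => by simp [h] at hkj
  constructor
  · intro i hi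
    have h1 : i ≠ j := fun h => by subst h; omega
    have h2 : i ≠ k := fun h => by subst h; omega
    simp [SimplicialRealization.shiftWeight, h1, h2, ha.lower i (by omega)]
  · intro i hi
    have h2 : i ≠ k := fun h => by subst h; omega
    by_cases h1 : i = j
    · subst h1
      rcases le_total (a (i, false)) (a (i, true)) with h' | h'
      · left; simp [SimplicialRealization.shiftWeight, h']
      · right; simp [SimplicialRealization.shiftWeight, h', h2]
    · have h3 : i.val ≠ j.val := fun h => h1 (Fin.ext h)
      simpa [SimplicialRealization.shiftWeight, h1, h2] using ha.upper i (by omega)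
  · intro i hi
    obtain rfl : i = k := Fin.ext hi
    by_cases hm : min (a (j, false)) (a (j, true)) = 0
    · left
      simp [SimplicialRealization.shiftWeight, hk, hm, ha.lower i (by omega)]
    · right
      rcases ha.missing j rfl with h' | ⟨l, hl, h'⟩
      · exact absurd (by rw [h', min_eq_right (h _)]) hm
      · have hlj : l ≠ j := by
          rintro rfl
          exact hm (by rw [h', min_eq_left (h _)])
        refine ⟨l, ?_, by simp [SimplicialRealization.shiftWeight, hlj, h']⟩
        have : l.val ≠ j.val := fun h => hlj (Fin.ext h)
        rw [Fin.le_def] at hl ⊢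
        omega

/-- A map whose coordinates satisfy `IsLevel j` is nullhomotopic in a complex that contains the
sets without pairs `(i, false), (i, true)`, `i ≠ 0`, and for `i₀ < j` the sets that avoid
`(i₀, false)` and contain no vertices `(i, true)`, `i + 1 < j`, and no pairs above `j`. -/
theorem nullhomotopic_of_isLevel {n : ℕ} (hn : 0 < n)
    (K : PreAbstractSimplicialComplex (Fin n × Bool))
    (hA : ∀ s : Finset (Fin n × Bool), s.Nonempty →
      (∀ i : Fin n, 0 < i.val → (i, false) ∉ s ∨ (i, true) ∉ s) → s ∈ K.faces)
    (hB : ∀ s : Finset (Fin n × Bool), s.Nonempty → ∀ i₀ k j : Fin n, i₀ ≤ k →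
      k.val + 1 = j.val → (i₀, false) ∉ s → (∀ i < k, (i, true) ∉ s) →
      (∀ i, j < i → (i, false) ∉ s ∨ (i, true) ∉ s) → s ∈ K.faces)
    {X : Type*} [TopologicalSpace X] (j : ℕ) (hj : j < n) (f : C(X, Realization K))
    (hf : ∀ x, IsLevel j fun p => (f x).coord p) : f.Nullhomotopic := by
  induction j generalizing f with
  | zero =>
    -- Cone point: `hA` puts no condition on index `0`, so `(0, false)` can be added to the support
    -- of every `f x`.
    let o : Fin n := ⟨0, hn⟩
    let g : C(X, Realization K) := ContinuousMap.const X
      { coord := Finsupp.single (o, false) 1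
        nonneg := fun a => by
          rw [Finsupp.single_apply]
          split_ifs <;> norm_num
        support_mem := by
          rw [show (Finsupp.single (o, false) (1 : ℝ)).support = {(o, false)} by simp]
          refine hA _ (Finset.singleton_nonempty _) fun i _ => Or.inr (by simp)
        sum_eq := Finsupp.sum_single_index rfl }
    refine ⟨_, homotopic_of_contiguous f g fun x => ?_⟩
    refine hA _ ((nonempty_support (f x).sum_eq).mono Finset.subset_union_left) fun i hi => ?_
    have hio : o ≠ i := fun h => by rw [← h] at hi; exact lt_irrefl _ hi
    have hg : (g x).coord = Finsupp.single (o, false) 1 := rfl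
    simpa [hg, Finsupp.single_apply, hio, hio.symm] using (hf x).upper i hi
  | succ k ih =>
    let j' : Fin n := ⟨k + 1, hj⟩
    let k' : Fin n := ⟨k, by omega⟩
    let a : X → Fin n × Bool → ℝ := fun x => shiftWeight k' j' fun p => (f x).coord p
    have hlev (x : X) : IsLevel k (a x) := (hf x).shiftWeight (k := k') (j := j') rfl (f x).nonneg
    have h1 (x : X) : ∑ p, a x p = 1 := by
      rw [sum_shiftWeight, ← (f x).sum_eq, Finsupp.sum_fintype _ _ fun _ => rfl]
    have hcont (x : X) : (f x).coord.support ∪ (Finsupp.equivFunOnFinite.symm (a x)).support ∈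
        K.faces := by
      have hne := (nonempty_support (f x).sum_eq).mono
        (Finset.subset_union_left (s₂ := (Finsupp.equivFunOnFinite.symm (a x)).support))
      have hmem (p) : p ∉ (f x).coord.support ∪ (Finsupp.equivFunOnFinite.symm (a x)).support ↔
          (f x).coord p = 0 ∧ a x p = 0 := by simp
      -- Without common weight the shift does nothing and the support has no pair at a positive
      -- index, so `hA` applies. With common weight, an unused `(l, false)` with `l ≤ k'` stays
      -- unused and `hB` applies to the union of the two supports.
      by_cases hm : min ((f x).coord (j', false)) ((f x).coord (j', true)) = 0
      · have ha : a x = fun p => (f x).coord p := by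
          funext p
          simp [a, shiftWeight, hm]
        refine hA _ hne fun i hi => ?_
        rw [hmem, hmem, ha, and_self, and_self]
        rcases lt_trichotomy i.val (k + 1) with h | h | h
        · exact Or.inr ((hf x).lower i h)
        · obtain rfl : i = j' := Fin.ext h
          rcases le_total ((f x).coord (j', false)) ((f x).coord (j', true)) with h' | h'
          · rw [min_eq_left h'] at hm
            exact Or.inl hm
          · rw [min_eq_right h'] at hm
            exact Or.inr hm
        · exact (hf x).upper i h
      · obtain ⟨l, hl, h'⟩ : ∃ l ≤ j', (f x).coord (l, false) = 0 := by
          refine ((hf x).missing j' rfl).resolve_left fun h' => hm ?_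
          rw [h', min_eq_right ((f x).nonneg _)]
        have hlj : l ≠ j' := by
          rintro rfl
          exact hm (by rw [h', min_eq_left ((f x).nonneg _)])
        have hlk : l ≤ k' := by
          have : l.val ≠ j'.val := fun h => hlj (Fin.ext h)
          simp only [Fin.le_def, j', k'] at hl this ⊢
          omega
        refine hB _ hne l k' j' hlk rfl ?_ (fun i hi => ?_) (fun i hi => ?_)
        · rw [hmem]
          exact ⟨h', by simp [a, shiftWeight, hlj, h']⟩
        · rw [hmem]
          exact ⟨(hf x).lower i (Nat.lt_succ_of_lt hi), (hlev x).lower i hi⟩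
        · rw [hmem, hmem]
          have hik : i ≠ k' := fun h => by
            rw [h] at hi
            simp only [Fin.lt_def, j', k'] at hi
            omega
          simpa [a, shiftWeight, hi.ne', hik] using (hf x).upper i hi
    let g : C(X, Realization K) := ofWeights K a
      ((continuous_shiftWeight k' j').comp
        (continuous_pi fun p => (continuous_coord K p).comp f.continuous))
      (fun x => shiftWeight_nonneg k' j' (f x).nonneg) h1 fun x =>
        (K.isRelLowerSet_faces (hcont x)).2 Finset.subset_union_right
          (nonempty_support (by
            rw [Finsupp.sum_fintype _ _ fun _ => rfl]
            exact h1 x))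
    obtain ⟨y, hy⟩ := ih (by omega) g hlev
    exact ⟨y, (homotopic_of_contiguous f g hcont).trans hy⟩

end SimplicialRealization
-- Determinants and maximal simplices.
namespace UBases

variable {F : Type*} [Field F]

theorem UVector.mk_congr (U : Subgroup Fˣ) {n : ℕ} {v w : Fin n → F} (hv : v ≠ 0) (hw : w ≠ 0)
    (h : v = w) : UVector.mk U v hv = UVector.mk U w hw := by
  subst h
  rfl

theorem UVector.self_mem_mk (U : Subgroup Fˣ) {n : ℕ} {v : Fin n → F} (hv : v ≠ 0) :
    v ∈ (UVector.mk U v hv).1 :=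
  ⟨1, U.one_mem, (one_smul _ v).symm⟩

theorem UVector.mk_smul (U : Subgroup Fˣ) {n : ℕ} {v : Fin n → F} (hv : v ≠ 0) {c : Fˣ}
    (hc : c ∈ U) (hcv : c • v ≠ 0) : UVector.mk U (c • v) hcv = UVector.mk U v hv :=
  UVector.eq_of_mem (self_mem_mk U hcv) ⟨c, hc, rfl⟩

/-- The determinant of some reordering of `n` vectors of determinant `d` lies in `U`. -/
def IsReorderedDet (U : Subgroup Fˣ) (n : ℕ) (d : F) : Prop :=
  ∃ τ : Equiv.Perm (Fin n), ∃ c ∈ U, ((Equiv.Perm.sign τ : ℤ) : F) * d = (c : F)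

theorem IsReorderedDet.ne_zero {U : Subgroup Fˣ} {n : ℕ} {d : F} (h : IsReorderedDet U n d) :
    d ≠ 0 := by
  rintro rfl
  obtain ⟨τ, c, -, h⟩ := h
  rw [mul_zero] at h
  exact c.ne_zero h.symm

theorem row_ne_zero {n : ℕ} {z : Fin n → Fin n → F} (h : (Matrix.of z).det ≠ 0) (i : Fin n) :
    z i ≠ 0 := fun hi =>
  h (Matrix.det_eq_zero_of_row_eq_zero i fun j => congrFun hi j)

theorem linearIndependent_of_det_ne_zero {n : ℕ} {z : Fin n → Fin n → F}
    (h : (Matrix.of z).det ≠ 0) : LinearIndependent F z :=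
  Matrix.linearIndependent_rows_iff_isUnit.2
    ((Matrix.isUnit_iff_isUnit_det (Matrix.of z)).2 (isUnit_iff_ne_zero.2 h))

theorem injective_mk {U : Subgroup Fˣ} {n : ℕ} {z : Fin n → Fin n → F}
    (h : (Matrix.of z).det ≠ 0) (hz : ∀ i, z i ≠ 0) :
    Function.Injective fun i => UVector.mk U (z i) (hz i) := by
  intro i j hij
  by_contra hne
  obtain ⟨c, -, hc⟩ : z i ∈ (UVector.mk U (z j) (hz j)).1 := by
    rw [← show UVector.mk U (z i) (hz i) = UVector.mk U (z j) (hz j) from hij]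
    exact UVector.self_mem_mk U (hz i)
  have hli := (linearIndependent_of_det_ne_zero h).comp ![i, j] (by
    intro a b
    fin_cases a <;> fin_cases b <;> simp [hne, Ne.symm hne])
  have hpair : LinearIndependent F ![z i, z j] := by
    convert hli using 1
    funext a
    fin_cases a <;> rfl
  refine one_ne_zero (LinearIndependent.pair_iff.1 hpair 1 (-(c : F)) ?_).1
  rw [hc, one_smul, neg_smul]
  exact add_neg_cancel _

open Classical in
theorem isDetPartialUBasis_image_mk {U : Subgroup Fˣ} {n : ℕ} {z : Fin n → Fin n → F}
    (h : IsReorderedDet U n (Matrix.of z).det) (hz : ∀ i, z i ≠ 0) :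
    IsDetPartialUBasis U (Finset.univ.image fun i => UVector.mk U (z i) (hz i)) := by
  have hinj := injective_mk (U := U) h.ne_zero hz
  refine ⟨⟨fun x => if hx : ∃ i, UVector.mk U (z i) (hz i) = x then z hx.choose else 0, ?_, ?_⟩,
    fun _ => ?_⟩
  · intro x hx
    have hx' : ∃ i, UVector.mk U (z i) (hz i) = x := by simpa using hx
    simp only [dif_pos hx']
    have := UVector.self_mem_mk U (hz hx'.choose)
    rwa [hx'.choose_spec] at this
  · have hli := linearIndependent_of_det_ne_zero h.ne_zero
    have hcard : Fintype.card (Fin n) = Module.finrank F (Fin n → F) := by simp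
    refine ⟨basisOfLinearIndependentOfCardEqFinrank' z hli hcard, ?_⟩
    rw [coe_basisOfLinearIndependentOfCardEqFinrank']
    rintro - ⟨x, hx, rfl⟩
    have hx' : ∃ i, UVector.mk U (z i) (hz i) = x := by simpa using hx
    simp only [dif_pos hx']
    exact ⟨_, rfl⟩
  · obtain ⟨τ, c, hc, h⟩ := h
    refine ⟨fun i => UVector.mk U (z (τ i)) (hz _), fun i => z (τ i), ?_,
      fun i => UVector.self_mem_mk U (hz _), c, hc, ?_⟩
    · rw [Finset.coe_image, Finset.coe_univ, Set.image_univ]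
      exact τ.surjective.range_comp fun i => UVector.mk U (z i) (hz i)
    · rw [det_columns, ← h]
      exact Matrix.det_permute τ (Matrix.of z)

/-- An ordering of the vertices of a maximal simplex has determinant in `U` up to reordering. -/
theorem isReorderedDet_of_isDetPartialUBasis {U : Subgroup Fˣ} {n : ℕ} {v : Fin n → Fin n → F}
    (hv : ∀ i, v i ≠ 0) (hinj : Function.Injective fun i => UVector.mk U (v i) (hv i))
    (h : IsDetPartialUBasis U (Finset.univ.map ⟨fun i => UVector.mk U (v i) (hv i), hinj⟩)) :
    IsReorderedDet U n (Matrix.of v).det := by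
  obtain ⟨e, w, he, hw, c, hc, hdet⟩ := h.2 (by simp)
  have hex (i : Fin n) : ∃ k, UVector.mk U (v k) (hv k) = e i := by
    have : e i ∈ Set.range e := ⟨i, rfl⟩
    rw [he] at this
    simpa using this
  choose t ht using hex
  have hsurj : Function.Surjective t := by
    intro k
    obtain ⟨i, hi⟩ : UVector.mk U (v k) (hv k) ∈ Set.range e := by
      rw [he]
      simp
    exact ⟨i, hinj ((ht i).trans hi)⟩
  let τ : Equiv.Perm (Fin n) := Equiv.ofBijective t (Finite.surjective_iff_bijective.1 hsurj)
  have hcoef (i : Fin n) : ∃ d ∈ U, w i = d • v (t i) := by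
    have := hw i
    rw [← ht i] at this
    exact this
  choose d hd hwd using hcoef
  -- The determinant `c` of the representatives `d i • v (τ i)` is `∏ d i` times `sign τ` times the
  -- determinant of `v`.
  refine ⟨τ, (∏ i, d i)⁻¹ * c, U.mul_mem (U.inv_mem (U.prod_mem fun i _ => hd i)) hc, ?_⟩
  rw [← Matrix.det_permute τ (Matrix.of v), Units.val_mul, ← hdet, det_columns,
    Units.val_inv_eq_inv_val, eq_inv_mul_iff_mul_eq₀ (Units.ne_zero _), Units.coe_prod]
  have : w = fun i => (d i : F) • v (t i) := funext hwd
  rw [this, AlternatingMap.map_smul_univ]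
  rfl

/-! ### The vectors `vᵢ`, their partial sums `wᵢ`, and the simplices they span. -/

/-- The vectors `vᵢ` and `v₀ + ⋯ + vᵢ`. -/
def vertexVec {n : ℕ} (v : Fin n → Fin n → F) (p : Fin n × Bool) : Fin n → F :=
  if p.2 then ∑ k ∈ Finset.Iic p.1, v k else v p.1

theorem filter_le_univ {n : ℕ} (i : Fin n) : Finset.univ.filter (· ≤ i) = Finset.Iic i := by
  ext
  simp

/-- For either choice of `c i`, row `i` of the transition matrix `T` has its last nonzero entry `1`
on the diagonal, so `T` is lower unitriangular. -/
theorem det_vertexVec {n : ℕ} (v : Fin n → Fin n → F) (c : Fin n → Bool) :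
    (Matrix.of fun i => vertexVec v (i, c i)).det = (Matrix.of v).det := by
  let T : Matrix (Fin n) (Fin n) F := Matrix.of fun i k =>
    if c i then (if k ≤ i then 1 else 0) else (if k = i then 1 else 0)
  have hT : (Matrix.of fun i => vertexVec v (i, c i)) = T * Matrix.of v := by
    ext i l
    simp only [Matrix.mul_apply, Matrix.of_apply, vertexVec, T]
    cases c i
    · simp
    · simp [Finset.sum_apply, ← Finset.sum_filter, filter_le_univ]
  have hTdet : T.det = 1 := by
    rw [Matrix.det_of_isLowerTriangular]
    · refine Finset.prod_eq_one fun i _ => ?_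
      simp [T]
    · intro i k hik
      have hik' : i < k := hik
      simp [T, hik'.not_ge, hik'.ne']
  rw [hT, Matrix.det_mul, hTdet, one_mul]

/-- Exchanging one of `v₀, …, v_k` for their sum does not change the determinant. -/
theorem det_update_vertexVec {n : ℕ} (v : Fin n → Fin n → F) (c : Fin n → Bool) {i k : Fin n}
    (hik : i ≤ k) (hc : ∀ l ≤ k, c l = false) :
    (Matrix.of (Function.update (fun i => vertexVec v (i, c i)) i (vertexVec v (k, true)))).det =
      (Matrix.of v).det := by
  have hIic : Finset.univ.filter (· ≤ k) = Finset.Iic k := filter_le_univ k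
  -- The rows up to `k` are the `vₗ` themselves, so `w_k` is a combination of the present rows; row
  -- `i` has coefficient `1` because `i ≤ k`.
  have hsum : vertexVec v (k, true) =
      ∑ l, (if l ≤ k then (1 : F) else 0) • vertexVec v (l, c l) := by
    simp only [ite_smul, one_smul, zero_smul]
    rw [← Finset.sum_filter, hIic]
    refine Finset.sum_congr rfl fun l hl => ?_
    rw [hc l (Finset.mem_Iic.1 hl)]
    rfl
  have := Matrix.det_updateRow_sum (Matrix.of fun i => vertexVec v (i, c i)) i
    (fun l => if l ≤ k then (1 : F) else 0)
  rw [if_pos hik, one_smul, det_vertexVec] at this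
  rw [hsum]
  exact this

theorem vertexVec_ne_zero {n : ℕ} {v : Fin n → Fin n → F} (h : (Matrix.of v).det ≠ 0)
    (p : Fin n × Bool) : vertexVec v p ≠ 0 :=
  row_ne_zero (z := fun i => vertexVec v (i, p.2)) (by rwa [det_vertexVec v fun _ => p.2]) p.1

/-- The vertices `[vᵢ]` and `[v₀ + ⋯ + vᵢ]`. -/
def vertex (U : Subgroup Fˣ) {n : ℕ} {v : Fin n → Fin n → F} (h : (Matrix.of v).det ≠ 0)
    (p : Fin n × Bool) : UVector U n :=
  UVector.mk U (vertexVec v p) (vertexVec_ne_zero h p)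

open Classical in
theorem isDetPartialUBasis_image_vertex {U : Subgroup Fˣ} {n : ℕ} {v : Fin n → Fin n → F}
    (h : IsReorderedDet U n (Matrix.of v).det) (s : Finset (Fin n × Bool))
    (hs : ∀ i : Fin n, 0 < i.val → (i, false) ∉ s ∨ (i, true) ∉ s) :
    IsDetPartialUBasis U (s.image (vertex U h.ne_zero)) := by
  let c : Fin n → Bool := fun i => decide ((i, true) ∈ s)
  have hD := isDetPartialUBasis_image_mk (U := U) (z := fun i => vertexVec v (i, c i))
    (by rwa [det_vertexVec]) fun i => vertexVec_ne_zero h.ne_zero _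
  refine hD.subset fun x hx => ?_
  obtain ⟨⟨i, b⟩, hp, rfl⟩ := Finset.mem_image.1 hx
  refine Finset.mem_image.2 ⟨i, Finset.mem_univ i, UVector.mk_congr _ _ _ ?_⟩
  by_cases hi : (i, true) ∈ s
  · rw [show c i = true from decide_eq_true hi]
    cases b
    -- Both copies of `i` occur only for `i = 0`, where `w₀ = v₀`.
    · have hi0 : i.val = 0 := by
        by_contra h0
        rcases hs i (Nat.pos_of_ne_zero h0) with h' | h'
        exacts [h' hp, h' hi]
      have : Finset.Iic i = {i} := by
        ext l
        rw [Finset.mem_Iic, Finset.mem_singleton, Fin.le_def, Fin.ext_iff]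
        omega
      simp [vertexVec, this]
    · rfl
  · rw [show c i = false from decide_eq_false hi]
    cases b
    · rfl
    · exact absurd hp hi

-- Start from the basis with `vᵢ` for `i ≤ j` and one of `vᵢ`, `wᵢ` for `i > j`, and exchange
-- `v_{i₀}` for `w_k`. This contains all vertices of `s` except possibly `[wⱼ]`, and `wⱼ = w_k + vⱼ`
-- makes that one an augmentation.
open Classical in
theorem isDet_or_isAug_image_vertex {U : Subgroup Fˣ} {n : ℕ} {v : Fin n → Fin n → F}
    (h : IsReorderedDet U n (Matrix.of v).det) (s : Finset (Fin n × Bool)) {i₀ k j : Fin n}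
    (hik : i₀ ≤ k) (hkj : k.val + 1 = j.val) (hi₀ : (i₀, false) ∉ s)
    (hlow : ∀ i < k, (i, true) ∉ s) (hup : ∀ i, j < i → (i, false) ∉ s ∨ (i, true) ∉ s) :
    IsDetPartialUBasis U (s.image (vertex U h.ne_zero)) ∨
      IsAugDetPartialUBasis U (s.image (vertex U h.ne_zero)) := by
  have hkj' : k < j := by
    rw [Fin.lt_def]
    omega
  let c : Fin n → Bool := fun i => decide (j < i ∧ (i, true) ∈ s)
  have hc : ∀ l ≤ j, c l = false := fun l hl => decide_eq_false fun h => h.1.not_ge hl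
  let z : Fin n → Fin n → F :=
    Function.update (fun i => vertexVec v (i, c i)) i₀ (vertexVec v (k, true))
  have hdet : IsReorderedDet U n (Matrix.of z).det := by
    rwa [det_update_vertexVec v c hik fun l hl => hc l (hl.trans hkj'.le)]
  have hz := row_ne_zero hdet.ne_zero
  have hD := isDetPartialUBasis_image_mk hdet hz
  have hinj := injective_mk (U := U) hdet.ne_zero hz
  set t := Finset.univ.image fun i => UVector.mk U (z i) (hz i) with ht
  have hji : j ≠ i₀ := (hik.trans_lt hkj').ne'
  have hzi : z i₀ = vertexVec v (k, true) := Function.update_self _ _ _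
  have hzne {i : Fin n} (hi : i ≠ i₀) : z i = vertexVec v (i, c i) := Function.update_of_ne hi _ _
  have hsub : s.image (vertex U h.ne_zero) ⊆ insert (vertex U h.ne_zero (j, true)) t := by
    intro x hx
    obtain ⟨⟨i, b⟩, hp, rfl⟩ := Finset.mem_image.1 hx
    rw [Finset.mem_insert]
    have hmem (l : Fin n) (hl : z l = vertexVec v (i, b)) : vertex U h.ne_zero (i, b) ∈ t :=
      Finset.mem_image.2 ⟨l, Finset.mem_univ l, UVector.mk_congr _ _ _ hl⟩
    cases b
    · have hi : i ≠ i₀ := fun h => hi₀ (h ▸ hp)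
      refine Or.inr (hmem i ?_)
      rw [hzne hi, show c i = false from decide_eq_false fun h' => ?_]
      rcases hup i h'.1 with h'' | h''
      exacts [h'' hp, h'' h'.2]
    · rcases lt_trichotomy i j with hij | rfl | hij
      · have hk : ¬ i < k := fun h => hlow i h hp
        have : i = k := by
          rw [Fin.lt_def] at hk hij
          exact Fin.ext (by omega)
        subst this
        exact Or.inr (hmem i₀ hzi)
      · exact Or.inl rfl
      · refine Or.inr (hmem i ?_)
        rw [hzne (hik.trans_lt (hkj'.trans hij)).ne', show c i = true from
          decide_eq_true ⟨hij, hp⟩]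
  -- Removing the extra vertex must give back `t`, so the augmentation needs `[wⱼ]` outside `t`; if
  -- it were in `t`, then `t` alone would suffice.
  by_cases h0 : vertex U h.ne_zero (j, true) ∈ t
  · rw [Finset.insert_eq_of_mem h0] at hsub
    exact Or.inl (hD.subset hsub)
  · refine IsAugDetPartialUBasis.subset ?_ hsub
    refine ⟨_, Finset.mem_insert_self _ _, ?_⟩
    rw [Finset.erase_insert h0]
    refine ⟨hD, _, Finset.mem_image_of_mem _ (Finset.mem_univ i₀), _,
      Finset.mem_image_of_mem _ (Finset.mem_univ j), hinj.ne hji.symm, _,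
      UVector.self_mem_mk U (vertexVec_ne_zero h.ne_zero (j, true)), _,
      UVector.self_mem_mk U (hz i₀), _, UVector.self_mem_mk U (hz j), 1, U.one_mem, 1, U.one_mem,
      ?_⟩
    have hIic : Finset.Iic j = insert j (Finset.Iic k) := by
      ext l
      simp only [Finset.mem_insert, Finset.mem_Iic, Fin.le_def, Fin.ext_iff]
      omega
    rw [one_smul, one_smul, hzi, hzne hji, hc j le_rfl, add_comm]
    simp only [vertexVec, if_true, hIic]
    rw [Finset.sum_insert (by simpa using hkj')]
    simp

/-! ### The sphere on formal vertices. -/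

/-- The formal vertices `(0, false), …, (n - 1, false), (m, true)`. -/
def sphereVertex {n : ℕ} (m : Fin n) : Fin (n + 1) → Fin n × Bool :=
  Fin.snoc (α := fun _ => Fin n × Bool) (fun i => (i, false)) (m, true)

theorem sphereVertex_castSucc {n : ℕ} (m i : Fin n) :
    sphereVertex m i.castSucc = (i, false) :=
  Fin.snoc_castSucc (α := fun _ => Fin n × Bool) _ _ _

theorem sphereVertex_last {n : ℕ} (m : Fin n) : sphereVertex m (Fin.last n) = (m, true) :=
  Fin.snoc_last (α := fun _ => Fin n × Bool) _ _

theorem sphereVertex_injective {n : ℕ} (m : Fin n) : Function.Injective (sphereVertex m) := by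
  intro a b
  refine Fin.lastCases ?_ (fun a => ?_) a <;> refine Fin.lastCases ?_ (fun b => ?_) b <;>
    simp [sphereVertex_castSucc, sphereVertex_last]

open SimplicialRealization

-- Omitting the last vertex leaves the `vᵢ`. Omitting `vᵢ` exchanges it for the full sum `w_m`, and
-- `i ≤ m` always holds as `m` is the top index.
open Classical in
theorem facetsIn_vertex {U : Subgroup Fˣ} {n : ℕ} (hn : 2 ≤ n) {v : Fin n → Fin n → F}
    (h : IsReorderedDet U n (Matrix.of v).det) {m : Fin n} (hm : m.val + 1 = n) :
    FacetsIn (BD U n) (vertex U h.ne_zero ∘ sphereVertex m) := by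
  refine facetsIn_iff.2 fun i => ⟨Finset.Nonempty.image ?_ _, ?_⟩
  · rw [← Finset.card_pos, Finset.card_erase_of_mem (Finset.mem_univ i)]
    simp only [Finset.card_univ, Fintype.card_fin]
    omega
  · induction i using Fin.lastCases with
    | last =>
      rw [← Finset.image_image]
      refine isDetPartialUBasis_image_vertex h _ fun i _ => Or.inr fun hi => ?_
      obtain ⟨l, hl, hl'⟩ := Finset.mem_image.1 hi
      induction l using Fin.lastCases with
      | last => simp at hl
      | cast l => simp [sphereVertex_castSucc] at hl'
    | cast i =>
      have him : i ≤ m := by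
        rw [Fin.le_def]
        omega
      have hdet := det_update_vertexVec v (fun _ => false) him fun _ _ => rfl
      have hdet' := h
      rw [← hdet] at hdet'
      refine (isDetPartialUBasis_image_mk hdet' (row_ne_zero hdet'.ne_zero)).subset fun x hx => ?_
      obtain ⟨l, hl, rfl⟩ := Finset.mem_image.1 hx
      induction l using Fin.lastCases with
      | last =>
        refine Finset.mem_image.2 ⟨i, Finset.mem_univ i, UVector.mk_congr _ _ (vertexVec_ne_zero h.ne_zero _) ?_⟩
        rw [Function.update_self, sphereVertex_last]
      | cast l =>
        refine Finset.mem_image.2 ⟨l, Finset.mem_univ l, UVector.mk_congr _ _ (vertexVec_ne_zero h.ne_zero _) ?_⟩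
        rw [Function.update_of_ne, sphereVertex_castSucc]
        rintro rfl
        simp at hl

open Classical in
theorem nullhomotopic_sphereMap_vertex {U : Subgroup Fˣ} {n : ℕ} {v : Fin n → Fin n → F}
    (h : IsReorderedDet U n (Matrix.of v).det) {m : Fin n} (hm : m.val + 1 = n)
    (w : Fin (n + 1) → UVector U n) (hw : w = vertex U h.ne_zero ∘ sphereVertex m)
    (hfaces : FacetsIn (BD U n) w) :
    ((inclusion (BD_le_BDA U n)).comp (sphereMap (BD U n) w hfaces)).Nullhomotopic := by
  subst hw
  -- The homotopy is built over formal vertices: they are finitely many, so continuity can be tested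
  -- on coordinates, although `BDA U n` may have infinitely many vertices. Formal vertices with the
  -- same image also stay distinct.
  let K := comap (vertex U h.ne_zero) (BDA U n)
  have hψ : FacetsIn K (sphereVertex m) := by
    refine facetsIn_iff.2 fun i => ?_
    have := facetsIn_iff.1 hfaces i
    refine mem_comap_faces.2 ⟨?_, ?_⟩
    · exact (Finset.image_nonempty.1 this.1).image _
    · rw [Finset.image_image]
      exact BD_le_BDA U n this
  have hcomp : (inclusion (BD_le_BDA U n)).comp (sphereMap (BD U n) _ hfaces) =
      (map K (BDA U n) (vertex U h.ne_zero) fun s hs => hs.2).comp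
        (sphereMap K (sphereVertex m) hψ) := by
    ext1 x
    apply Realization.ext
    change Finsupp.mapDomain id (Finsupp.mapDomain _ _) =
      Finsupp.mapDomain _ (Finsupp.mapDomain _ _)
    rw [Finsupp.mapDomain_id, Finsupp.mapDomain_comp]
  rw [hcomp]
  refine ContinuousMap.Nullhomotopic.comp_right ?_ _
  refine nullhomotopic_of_isLevel (by omega) K ?_ ?_ m.val m.2 _ fun x => ?_
  · exact fun s hne hs => mem_comap_faces.2
      ⟨hne, hne.image _, Or.inl (isDetPartialUBasis_image_vertex h s hs)⟩
  · exact fun s hne i₀ k j hik hkj h1 h2 h3 => mem_comap_faces.2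
      ⟨hne, hne.image _, isDet_or_isAug_image_vertex h s hik hkj h1 h2 h3⟩
  · have hx (a : Fin (n + 1)) :
        (sphereMap K (sphereVertex m) hψ x).coord (sphereVertex m a) = x.coord a :=
      Finsupp.mapDomain_apply (sphereVertex_injective m) x.coord a
    constructor
    · intro i hi
      refine Finsupp.mapDomain_of_notMem_range _ _ ?_
      rintro ⟨a, ha⟩
      induction a using Fin.lastCases with
      | last =>
        rw [sphereVertex_last, Prod.mk.injEq] at ha
        rw [ha.1] at hi
        exact lt_irrefl _ hi
      | cast a => simp [sphereVertex_castSucc] at ha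
    · intro i hi
      omega
    · intro i hi
      obtain rfl : i = m := Fin.ext hi
      -- A point of the boundary misses a vertex of the simplex; this starts the descent at level
      -- `m`.
      obtain ⟨a, ha⟩ : ∃ a, a ∉ x.coord.support := by
        by_contra! h'
        exact x.support_mem.2 (Finset.eq_univ_iff_forall.2 h')
      rw [Finsupp.notMem_support_iff, ← hx] at ha
      induction a using Fin.lastCases with
      | last => exact Or.inl (by rwa [sphereVertex_last] at ha)
      | cast a =>
        refine Or.inr ⟨a, ?_, by rwa [sphereVertex_castSucc] at ha⟩
        rw [Fin.le_def]
        omega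

end UBases

/-! ### The theorem. -/

theorem lemma2p16 {F : Type*} [Field F] (U : Subgroup Fˣ) (n : ℕ) (hn : 2 ≤ n)
    (v : Fin n → Fin n → F) (hv : ∀ i, v i ≠ 0)
    (hinj : Function.Injective fun i => UBases.UVector.mk U (v i) (hv i))
    (hσ : Finset.univ.map ⟨fun i => UBases.UVector.mk U (v i) (hv i), hinj⟩ ∈
      (UBases.BD U n).faces)
    (u : Fin n → Fˣ) (hu : ∀ i, u i ∈ U) :
    ∃ (hw : ∑ i, u i • v i ≠ 0)
      (hfaces : SimplicialRealization.FacetsIn (UBases.BD U n)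
        (Fin.snoc (α := fun _ => UBases.UVector U n) (fun i => UBases.UVector.mk U (v i) (hv i))
          (UBases.UVector.mk U (∑ i, u i • v i) hw))),
      ((SimplicialRealization.inclusion (UBases.BD_le_BDA U n)).comp
        (SimplicialRealization.sphereMap (UBases.BD U n) _ hfaces)).Nullhomotopic := by
  have h0 := UBases.isReorderedDet_of_isDetPartialUBasis hv hinj hσ.2
  -- Absorb the coefficients: the rows `u i • v i` represent the same `U`-vectors, and the
  -- determinant changes by `∏ u i ∈ U`.
  have h : UBases.IsReorderedDet U n (Matrix.of fun i => u i • v i).det := by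
    obtain ⟨τ, c, hc, hτ⟩ := h0
    refine ⟨τ, (∏ i, u i) * c, U.mul_mem (U.prod_mem fun i _ => hu i) hc, ?_⟩
    rw [Units.val_mul, ← hτ, mul_left_comm, Units.coe_prod]
    exact congrArg _ (Matrix.det_mul_column (fun i => (u i : F)) (Matrix.of v))
  let m : Fin n := ⟨n - 1, by omega⟩
  have hm : m.val + 1 = n := Nat.sub_add_cancel (by omega)
  have hsum : UBases.vertexVec (fun i => u i • v i) (m, true) = ∑ i, u i • v i := by
    have : Finset.Iic m = Finset.univ := by
      refine Finset.eq_univ_iff_forall.2 fun i => Finset.mem_Iic.2 ?_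
      rw [Fin.le_def]
      omega
    simp [UBases.vertexVec, this]
  have hw : ∑ i, u i • v i ≠ 0 := hsum ▸ UBases.vertexVec_ne_zero h.ne_zero (m, true)
  have heq : Fin.snoc (α := fun _ => UBases.UVector U n)
      (fun i => UBases.UVector.mk U (v i) (hv i)) (UBases.UVector.mk U (∑ i, u i • v i) hw) =
      UBases.vertex U h.ne_zero ∘ UBases.sphereVertex m := by
    funext a
    induction a using Fin.lastCases with
    | last =>
      rw [Fin.snoc_last, Function.comp_apply, UBases.sphereVertex_last]
      exact UBases.UVector.mk_congr _ _ _ hsum.symm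
    | cast i =>
      rw [Fin.snoc_castSucc, Function.comp_apply, UBases.sphereVertex_castSucc]
      exact (UBases.UVector.mk_smul U (hv i) (hu i) _).symm
  have hfaces := heq ▸ UBases.facetsIn_vertex hn h hm
  exact ⟨hw, hfaces, UBases.nullhomotopic_sphereMap_vertex h hm _ heq hfaces⟩
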